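/- Let $(\Omega,\mathcal F,\mathbb P)$ be a probability space, let $N_\alpha$ ($\alpha$ in a finite index set) be independent standard (rate one) Poisson processes on it, and put $\tilde N_\alpha(t)=N_\alpha(t)-t$. Let $\mathcal H_S$ be a complex Hilbert space, $H$ a self-adjoint operator and $L_\alpha$ bounded operators on $\mathcal H_S$, and $\phi_0\in\mathcal H_S$ a unit vector. Let $|\psi_t\rangle$, $t\ge 0$, be a right-continuous $\mathcal H_S$-valued process with left limits which is a (strong) solution of $$d|\psi_t\rangle=\Big(\sum_\alpha L_\alpha\,d\tilde N_\alpha-\big(iH+\tfrac12\sum_\alpha L_\alpha^\dagger L_\alpha\big)dt\Big)|\psi_t\rangle,\qquad |\psi_0\rangle=|\phi_0\rangle ,$$ where stochastic integrals are pathwise and integrands that depend on the noise are evaluated at left limits. Let $$R_\alpha=\frac{\langle\psi_{t-}|L_\alpha+L_\alpha^\dagger+L_\alpha^\dagger L_\alpha|\psi_{t-}\rangle}{\langle\psi_{t-}|\psi_{t-}\rangle}\ \ (\text{with } R_\alpha=0 \text{ if } \psi_{t-}=0),\qquad c_\alpha=\frac1{\sqrt{1+R_\alpha}}\ \ (\text{with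 } c_\alpha=0 \text{ where } R_\alpha=-1),$$ $$\Phi_t=\exp\Big(\sum_\alpha\int_0^t\big[\tfrac12(R_\alpha-2)+c_\alpha\big]ds\Big)\,\mathcal E\Big(\sum_\alpha\int_0^{\cdot}(c_\alpha-1)\,d\tilde N_\alpha\Big)_t ,$$ where $\mathcal E(X)_t=e^{X_t-X_0}\prod_{0<s\le t}(1+\Delta X_s)e^{-\Delta X_s}$ is the Doléans-Dade exponential of a process $X$ of finite variation with finitely many jumps on bounded intervals. Then almost surely, for all $t\ge0$: 1. $\psi_t\ne0$ if and only if $R_\alpha>-1$ at every jump time $s\in(0,t]$ of every $N_\alpha$. 2. If $\psi_t\neq 0$ and every $c_\alpha$ is integrable on $[0,t]$ (so that $\Phi_t$ is defined), then $\Phi_t^*\Phi_t=\langle\psi_t|\psi_t\rangle^{-1}$; hence $\Phi_t$ normalizes the unravelling: $\|\Phi_t\psi_t\|=1$. 3. If $\psi_t\ne0$, then, whether or not the $c_\alpha$ are integrable, $(\Phi^{(m)}_t)^*\Phi^{(m)}_t\to\langle\psi_t|\psi_t\rangle^{-1}$ as $m\to\infty$, where $\Phi^{(m)}$ is defined as $\Phi$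 with $\min(c_\alpha,m)$ in place of $c_\alpha$. -/

import Mathlib

open MeasureTheory ProbabilityTheory Filter Topology
open scoped NNReal

noncomputable section

namespace PoissonUnravelling

/-- A standard (rate one) Poisson process: almost every path starts at `0`, is nondecreasing and
right-continuous with values in `ℕ`; increments are independent, and the increment over `(s, t]`
is Poisson distributed with mean `t - s`. -/
structure IsPoissonProcess {Ω : Type*} [MeasurableSpace Ω] (P : Measure Ω)
    (N : ℝ≥0 → Ω → ℕ) : Prop where
  measurable : ∀ t, Measurable (N t)
  zero : ∀ᵐ ω ∂P, N 0 ω = 0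
  mono : ∀ᵐ ω ∂P, Monotone fun t => N t ω
  rightCont : ∀ᵐ ω ∂P, ∀ t, ContinuousWithinAt (fun s => N s ω) (Set.Ici t) t
  indep : HasIndepIncrements N P
  law : ∀ s t, s ≤ t → HasLaw (N t - N s) (poissonMeasure (t - s)) P

/-- A family of independent standard Poisson processes. -/
structure IsPoissonFamily {Ω ι : Type*} [MeasurableSpace Ω] (P : Measure Ω)
    (N : ι → ℝ≥0 → Ω → ℕ) : Prop where
  poisson : ∀ α, IsPoissonProcess P (N α)
  indep : iIndepFun (fun α ω t => N α t ω) P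

/-- The jump at time `s` of a nondecreasing path with values in `ℕ`. -/
def jump (n : ℝ≥0 → ℕ) (s : ℝ≥0) : ℕ := n s - Function.leftLim n s

/-- The time integral of `g` over `[0, t]`. -/
def timeIntegral {F : Type*} [NormedAddCommGroup F] [NormedSpace ℝ F] (g : ℝ≥0 → F) (t : ℝ≥0) : F :=
  ∫ s in (0 : ℝ)..t, g s.toNNReal

/-- `g` is Lebesgue integrable over `[0, t]`. -/
def TimeIntegrable {F : Type*} [NormedAddCommGroup F] (g : ℝ≥0 → F) (t : ℝ≥0) : Prop :=
  IntervalIntegrable (fun s : ℝ => g s.toNNReal) volume 0 t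

/-- The pathwise stochastic integral of the integrand `g` over `(0, t]` against the compensated
process with counting path `n`: the sum of `g` over the jump times (finitely many), with their
multiplicities, minus the time integral of `g`. Processes that depend on the noise are inserted
as integrands through their left limits. -/
def compInt {F : Type*} [NormedAddCommGroup F] [NormedSpace ℝ F] (n : ℝ≥0 → ℕ) (g : ℝ≥0 → F)
    (t : ℝ≥0) : F :=
  (∑ᶠ s ∈ Set.Ioc 0 t, jump n s • g s) - timeIntegral g t

/-- The Doléans-Dade exponential of a path `x` of finite variation with finitely many jumps on
bounded intervals: `exp (x t - x 0) * ∏ (1 + Δx s) * exp (-Δx s)`, with the product over the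
jump times `s` in `(0, t]`. -/
def doleansDade (x : ℝ≥0 → ℝ) (t : ℝ≥0) : ℝ :=
  Real.exp (x t - x 0) * ∏ᶠ s ∈ Set.Ioc 0 t,
    (1 + (x s - Function.leftLim x s)) * Real.exp (-(x s - Function.leftLim x s))

section System

variable {E ι : Type*} [NormedAddCommGroup E] [InnerProductSpace ℂ E]

open Classical in
/-- The value at `v` of a possibly unbounded operator, extended by `0` off its domain. -/
def applyOp (H : E →ₗ.[ℂ] E) (v : E) : E :=
  if h : v ∈ H.domain then H ⟨v, h⟩ else 0

variable [CompleteSpace E]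

/-- The drift `(i H + 1/2 ∑ L_α† L_α) v`. -/
def drift [Fintype ι] (H : E →ₗ.[ℂ] E) (L : ι → E →L[ℂ] E) (v : E) : E :=
  Complex.I • applyOp H v +
    (1 / 2 : ℂ) • ∑ α, (ContinuousLinearMap.adjoint (L α)) (L α v)

/-- `ψ` is a path of a (strong, right-continuous with left limits) solution of
`dψ = (∑ L_α dÑ_α - (i H + 1/2 ∑ L_α† L_α) dt) ψ`, `ψ 0 = φ₀`, for the counting paths `n α`. -/
structure IsSolutionPath [Fintype ι] (n : ι → ℝ≥0 → ℕ) (H : E →ₗ.[ℂ] E) (L : ι → E →L[ℂ] E)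
    (φ₀ : E) (ψ : ℝ≥0 → E) : Prop where
  rightCont : ∀ t, ContinuousWithinAt ψ (Set.Ici t) t
  leftLimit : ∀ t, ∃ l, Tendsto ψ (𝓝[<] t) (𝓝 l)
  mem_domain : ∀ᵐ s : ℝ, 0 ≤ s → ψ s.toNNReal ∈ H.domain
  integrable : ∀ t, TimeIntegrable (fun s => drift H L (ψ s)) t
  eq : ∀ t, ψ t = φ₀ + ∑ α, compInt (n α) (fun s => L α (Function.leftLim ψ s)) t
    - timeIntegral (fun s => drift H L (ψ s)) t

/-- `R = ⟨v | L + L† + L† L | v⟩ / ⟨v | v⟩`. -/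
def relRate (L : E →L[ℂ] E) (v : E) : ℝ :=
  (inner ℂ v (L v + ContinuousLinearMap.adjoint L v + ContinuousLinearMap.adjoint L (L v))).re /
    (inner ℂ v v).re

/-- The predictable process `R_α` along the path `ψ`, evaluated at the left limit of `ψ`. -/
def rate (L : ι → E →L[ℂ] E) (ψ : ℝ≥0 → E) (α : ι) (s : ℝ≥0) : ℝ :=
  relRate (L α) (Function.leftLim ψ s)

/-- The predictable process `c_α = (1 + R_α)^(-1/2)`; its value is `0` where `R_α = -1`. -/
def coeff (L : ι → E →L[ℂ] E) (ψ : ℝ≥0 → E) (α : ι) (s : ℝ≥0) : ℝ :=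
  (Real.sqrt (1 + rate L ψ α s))⁻¹

end System

/-- `exp (∑ ∫ (1/2 (r_α - 2) + c_α) ds)` times the Doléans-Dade exponential of
`∑ ∫ (c_α - 1) dÑ_α`. -/
def normalizer {ι : Type*} [Fintype ι] (n : ι → ℝ≥0 → ℕ) (r c : ι → ℝ≥0 → ℝ) (t : ℝ≥0) : ℝ :=
  Real.exp (∑ α, timeIntegral (fun s => 1 / 2 * (r α s - 2) + c α s) t) *
    doleansDade (fun u => ∑ α, compInt (n α) (fun s => c α s - 1) u) t

section Phi

variable {E ι : Type*} [Fintype ι] [NormedAddCommGroup E] [InnerProductSpace ℂ E] [CompleteSpace E]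

/-- The process `Φ` along the path `ψ`, with `c_α = (1 + R_α)^(-1/2)`, as a complex number. -/
def Phi (n : ι → ℝ≥0 → ℕ) (L : ι → E →L[ℂ] E) (ψ : ℝ≥0 → E) (t : ℝ≥0) : ℂ :=
  (normalizer n (rate L ψ) (coeff L ψ) t : ℝ)

/-- The same expression with the truncated coefficients `min c_α m` in place of `c_α`. -/
def PhiTrunc (n : ι → ℝ≥0 → ℕ) (L : ι → E →L[ℂ] E) (ψ : ℝ≥0 → E) (m : ℕ) (t : ℝ≥0) : ℂ :=
  (normalizer n (rate L ψ) (fun α s => min (coeff L ψ α s) m) t : ℝ)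

end Phi

end PoissonUnravelling

end

namespace PoissonUnravelling

section Poisson

lemma poissonMeasure_one_le (r : ℝ≥0) :
    poissonMeasure r {k | 1 ≤ k} ≤ ENNReal.ofReal r := by
  have h : {k : ℕ | 1 ≤ k} = {0}ᶜ := by ext k; simp; omega
  rw [← ofReal_measureReal, h, probReal_compl_eq_one_sub (measurableSet_singleton _),
    poissonMeasure_real_singleton]
  apply ENNReal.ofReal_le_ofReal
  have := Real.add_one_le_exp (-(r : ℝ))
  simp
  linarith

lemma poissonMeasure_two_le (r : ℝ≥0) :
    poissonMeasure r {k | 2 ≤ k} ≤ ENNReal.ofReal ((r : ℝ) ^ 2) := by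
  have h : {k : ℕ | 2 ≤ k} = ({0} ∪ {1})ᶜ := by ext k; simp; omega
  rw [← ofReal_measureReal, h, probReal_compl_eq_one_sub (.of_discrete),
    measureReal_union (by simp) (.of_discrete), poissonMeasure_real_singleton,
    poissonMeasure_real_singleton]
  apply ENNReal.ofReal_le_ofReal
  have := Real.add_one_le_exp (-(r : ℝ))
  have h0 : (0 : ℝ) ≤ r := r.2
  simp
  nlinarith

variable {Ω : Type*} [MeasurableSpace Ω] {P : Measure Ω}

/-- Events attached to time intervals whose probability is quadratically small in the length of
the interval almost surely do not occur along all intervals `(s, t]` around a common time. -/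
lemma ae_not_exists_common_time (B : ℝ≥0 → ℝ≥0 → Set Ω)
    (hB : ∀ s t, s ≤ t → P (B s t) ≤ ENNReal.ofReal (((t - s : ℝ≥0) : ℝ) ^ 2)) :
    ∀ᵐ ω ∂P, ¬ ∃ u : ℝ≥0, 0 < u ∧ ∀ s t, s < u → u ≤ t → ω ∈ B s t := by
  have key : ∀ T : ℕ, P {ω | ∃ u : ℝ≥0, 0 < u ∧ u ≤ T ∧ ∀ s t, s < u → u ≤ t → ω ∈ B s t} = 0 := by
    intro T
    have bound : ∀ n : ℕ, P {ω | ∃ u : ℝ≥0, 0 < u ∧ u ≤ T ∧ ∀ s t, s < u → u ≤ t → ω ∈ B s t} ≤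
        ENNReal.ofReal ((T : ℝ) ^ 2 * (1 / ((n : ℝ) + 1))) := by
      intro n
      have hn : (0 : ℝ≥0) < n + 1 := by positivity
      set p : ℕ → ℝ≥0 := fun k => k * T / (n + 1) with hp
      have hsub : {ω | ∃ u : ℝ≥0, 0 < u ∧ u ≤ T ∧ ∀ s t, s < u → u ≤ t → ω ∈ B s t} ⊆
          ⋃ k ∈ Finset.range (n + 1), B (p k) (p (k + 1)) := by
        rintro ω ⟨u, hu0, huT, hu⟩
        have hT : (0 : ℝ≥0) < T := hu0.trans_le huT
        have hex : ∃ k, u ≤ p k := ⟨n + 1, by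
          rw [hp]; push_cast; rwa [mul_div_cancel_left₀ _ hn.ne']⟩
        classical
        have hk := Nat.find_spec hex
        have hk0 : Nat.find hex ≠ 0 := by
          intro h
          rw [h] at hk
          simp [hp] at hk
          exact hu0.ne' hk
        obtain ⟨j, hj⟩ := Nat.exists_eq_succ_of_ne_zero hk0
        have hjn : j < n + 1 := by
          have : Nat.find hex ≤ n + 1 := Nat.find_min' hex (by
            rw [hp]; push_cast; rwa [mul_div_cancel_left₀ _ hn.ne'])
          omega
        simp only [Set.mem_iUnion, Finset.mem_range]
        refine ⟨j, hjn, hu _ _ ?_ ?_⟩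
        · exact not_le.1 (Nat.find_min hex (by omega))
        · rw [hj] at hk; exact hk
      calc _ ≤ P (⋃ k ∈ Finset.range (n + 1), B (p k) (p (k + 1))) := measure_mono hsub
        _ ≤ ∑ k ∈ Finset.range (n + 1), P (B (p k) (p (k + 1))) := measure_biUnion_finset_le _ _
        _ ≤ ∑ k ∈ Finset.range (n + 1), ENNReal.ofReal (((T : ℝ) / (n + 1)) ^ 2) := by
            refine Finset.sum_le_sum fun k _ => ?_
            have hle : p k ≤ p (k + 1) := by
              simp only [hp]; push_cast; gcongr; simp
            refine (hB _ _ hle).trans (le_of_eq ?_)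
            rw [NNReal.coe_sub hle]
            congr 2
            simp only [hp]
            push_cast
            ring
        _ = _ := by
            rw [Finset.sum_const, nsmul_eq_mul, Finset.card_range, ← ENNReal.ofReal_natCast,
              ← ENNReal.ofReal_mul (by positivity)]
            congr 1
            push_cast
            field_simp
    have hlim : Tendsto (fun n : ℕ => ENNReal.ofReal ((T : ℝ) ^ 2 * (1 / ((n : ℝ) + 1)))) atTop
        (𝓝 0) := by
      have := (tendsto_one_div_add_atTop_nhds_zero_nat (𝕜 := ℝ)).const_mul ((T : ℝ) ^ 2)
      simpa using ENNReal.tendsto_ofReal this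
    exact le_antisymm (ge_of_tendsto' hlim bound) zero_le
  rw [ae_iff]
  refine measure_mono_null ?_ (measure_iUnion_null key)
  intro ω hω
  simp only [not_not, Set.mem_ofPred_eq] at hω
  obtain ⟨u, hu0, hu⟩ := hω
  obtain ⟨T, hT⟩ := exists_nat_ge u
  exact Set.mem_iUnion.2 ⟨T, u, hu0, hT, hu⟩

lemma jump_le_sub {n : ℝ≥0 → ℕ} (hn : Monotone n) {s u t : ℝ≥0} (hs : s < u) (ht : u ≤ t) :
    jump n u ≤ n t - n s :=
  tsub_le_tsub (hn ht) (hn.le_leftLim hs)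

/-- A Poisson process almost surely has jumps of size one only. -/
lemma IsPoissonProcess.ae_jump_le_one {N : ℝ≥0 → Ω → ℕ} (hN : IsPoissonProcess P N) :
    ∀ᵐ ω ∂P, ∀ u, 0 < u → jump (fun s => N s ω) u ≤ 1 := by
  have := ae_not_exists_common_time (P := P) (fun s t => {ω | 2 ≤ (N t - N s) ω}) (fun s t hst => by
    rw [(hN.law s t hst).measure_eq (p := fun k => 2 ≤ k) (.of_discrete)]
    exact poissonMeasure_two_le _)
  filter_upwards [this, hN.mono] with ω h hmono u hu
  by_contra hj
  push Not at hj
  exact h ⟨u, hu, fun s t hs ht => hj.trans_le (jump_le_sub hmono hs ht)⟩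

/-- Independent Poisson processes almost surely have no common jumps. -/
lemma IsPoissonFamily.ae_no_common_jump {ι : Type*} {N : ι → ℝ≥0 → Ω → ℕ}
    (hN : IsPoissonFamily P N) {α β : ι} (hαβ : α ≠ β) :
    ∀ᵐ ω ∂P, ∀ u, 0 < u → jump (fun s => N α s ω) u ≠ 0 → jump (fun s => N β s ω) u = 0 := by
  have := ae_not_exists_common_time (P := P)
    (fun s t => {ω | 1 ≤ (N α t - N α s) ω} ∩ {ω | 1 ≤ (N β t - N β s) ω}) (fun s t hst => by
      have hm : Measurable fun x : ℝ≥0 → ℕ => x t - x s :=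
        (measurable_pi_apply t).sub (measurable_pi_apply s)
      have hi : IndepFun (N α t - N α s) (N β t - N β s) P :=
        (hN.indep.indepFun hαβ).comp hm hm
      have h1 := hi.measure_inter_preimage_eq_mul {k | 1 ≤ k} {k | 1 ≤ k} .of_discrete .of_discrete
      refine (le_of_eq h1).trans ?_
      have hl : ∀ γ, P ((N γ t - N γ s) ⁻¹' {k | 1 ≤ k}) ≤ ENNReal.ofReal ((t - s : ℝ≥0) : ℝ) :=
        fun γ => by
          have := ((hN.poisson γ).law s t hst).measure_eq (p := fun k => 1 ≤ k) (.of_discrete)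
          exact this.le.trans (poissonMeasure_one_le _)
      rw [sq, ENNReal.ofReal_mul (by positivity)]
      exact mul_le_mul' (hl α) (hl β))
  filter_upwards [this, (hN.poisson α).mono, (hN.poisson β).mono] with ω h hα hβ u hu hj
  by_contra hj'
  exact h ⟨u, hu, fun s t hs ht =>
    ⟨(Nat.one_le_iff_ne_zero.2 hj).trans (jump_le_sub hα hs ht),
      (Nat.one_le_iff_ne_zero.2 hj').trans (jump_le_sub hβ hs ht)⟩⟩

end Poisson

/-- Nondecreasing counting paths with jumps of size one and without common jumps. -/
structure IsSimpleFamily {ι : Type*} (n : ι → ℝ≥0 → ℕ) : Prop where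
  mono : ∀ α, Monotone (n α)
  jump_le_one : ∀ α s, 0 < s → jump (n α) s ≤ 1
  no_common_jump : ∀ α β, α ≠ β → ∀ s, 0 < s → jump (n α) s ≠ 0 → jump (n β) s = 0

lemma IsPoissonFamily.ae_isSimpleFamily {Ω ι : Type*} [MeasurableSpace Ω] {P : Measure Ω}
    [Countable ι] {N : ι → ℝ≥0 → Ω → ℕ} (hN : IsPoissonFamily P N) :
    ∀ᵐ ω ∂P, IsSimpleFamily fun α s => N α s ω := by
  have h1 := ae_all_iff.2 fun α => (hN.poisson α).mono
  have h2 := ae_all_iff.2 fun α => (hN.poisson α).ae_jump_le_one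
  have h3 : ∀ᵐ ω ∂P, ∀ α β, α ≠ β → ∀ s, 0 < s → jump (fun s => N α s ω) s ≠ 0 →
      jump (fun s => N β s ω) s = 0 :=
    ae_all_iff.2 fun α => ae_all_iff.2 fun β => by
      by_cases h : α = β
      · simp [h]
      · filter_upwards [hN.ae_no_common_jump h] with ω hω _ using hω
  filter_upwards [h1, h2, h3] with ω a b c using ⟨a, b, c⟩

end PoissonUnravelling

section AbsolutelyContinuous

open AbsolutelyContinuousOnInterval in
lemma AbsolutelyContinuousOnInterval.of_dist_le {X Y : Type*} [PseudoMetricSpace X]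
    [PseudoMetricSpace Y] {f : ℝ → X} {g : ℝ → Y} {a b K : ℝ}
    (hf : AbsolutelyContinuousOnInterval f a b)
    (h : ∀ x ∈ Set.uIcc a b, ∀ y ∈ Set.uIcc a b, dist (g x) (g y) ≤ K * dist (f x) (f y)) :
    AbsolutelyContinuousOnInterval g a b := by
  unfold AbsolutelyContinuousOnInterval at hf ⊢
  refine squeeze_zero' ?_ ?_ (by simpa using hf.const_mul K)
  · exact Eventually.of_forall fun _ => Finset.sum_nonneg fun _ _ => dist_nonneg
  · rw [eventually_inf_principal]
    filter_upwards with E hE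
    rw [Finset.mul_sum]
    exact Finset.sum_le_sum fun i hi => h _ (hE.1 i hi).1 _ (hE.1 i hi).2

lemma IntervalIntegrable.absolutelyContinuousOnInterval_primitive {E : Type*}
    [NormedAddCommGroup E] [NormedSpace ℝ E] {f : ℝ → E} {a b : ℝ}
    (hf : IntervalIntegrable f volume a b) :
    AbsolutelyContinuousOnInterval (fun x => ∫ v in a..x, f v) a b := by
  refine (hf.norm.absolutelyContinuousOnInterval_intervalIntegral
    Set.left_mem_uIcc).of_dist_le (K := 1) fun x hx y hy => ?_
  have hs : ∀ z ∈ Set.uIcc a b, IntervalIntegrable f volume a z := fun z hz =>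
    hf.mono_set (Set.uIcc_subset_uIcc_left hz)
  rw [dist_eq_norm, Real.dist_eq, one_mul,
    intervalIntegral.integral_interval_sub_left (hs x hx) (hs y hy),
    intervalIntegral.integral_interval_sub_left (hs x hx).norm (hs y hy).norm]
  exact intervalIntegral.norm_integral_le_abs_integral_norm

lemma AbsolutelyContinuousOnInterval.rexp {f : ℝ → ℝ} {a b : ℝ}
    (hf : AbsolutelyContinuousOnInterval f a b) :
    AbsolutelyContinuousOnInterval (fun x => Real.exp (f x)) a b := by
  obtain ⟨C, hC⟩ := hf.exists_bound
  obtain ⟨K, hK⟩ := (Real.contDiff_exp.contDiffOn (s := Set.Icc (-C) C)).exists_lipschitzOnWith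
    (n := 1) (by decide) (convex_Icc _ _) isCompact_Icc
  refine hf.of_dist_le (K := K) fun x hx y hy => ?_
  exact hK.dist_le_mul _ (abs_le.1 (hC x hx)) _ (abs_le.1 (hC y hy))

end AbsolutelyContinuous

section Energy

variable {E : Type*} [NormedAddCommGroup E] [InnerProductSpace ℂ E] [CompleteSpace E]

/-- Norm evolution along an absolutely continuous path with `φ' = -f` and
`2 Re ⟪φ, f⟫ = ρ ‖φ‖²` almost everywhere. -/
lemma norm_sq_mul_exp_integral_eq {f φ : ℝ → E} {ρ : ℝ → ℝ} {a b : ℝ} {x : E} (hab : a ≤ b)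
    (hf : IntervalIntegrable f volume a b) (hρ : IntervalIntegrable ρ volume a b)
    (hφ : ∀ t, φ t = x - ∫ s in a..t, f s)
    (h : ∀ᵐ t, t ∈ Set.Ioo a b → 2 * (inner ℂ (φ t) (f t)).re = ρ t * ‖φ t‖ ^ 2) :
    ‖φ b‖ ^ 2 * Real.exp (∫ s in a..b, ρ s) = ‖x‖ ^ 2 := by
  let _ : InnerProductSpace ℝ E := InnerProductSpace.rclikeToReal ℂ E
  have hφac : AbsolutelyContinuousOnInterval φ a b :=
    hf.absolutelyContinuousOnInterval_primitive.of_dist_le (K := 1) fun y _ z _ => by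
      rw [hφ, hφ, one_mul, dist_eq_norm, dist_eq_norm, sub_sub_sub_cancel_left, norm_sub_rev]
  have hnac : AbsolutelyContinuousOnInterval (fun t => ‖φ t‖) a b :=
    hφac.of_dist_le (K := 1) fun y _ z _ => by
      rw [one_mul, Real.dist_eq, dist_eq_norm]; exact abs_norm_sub_norm_le _ _
  have hac : AbsolutelyContinuousOnInterval
      (fun t => ‖φ t‖ ^ 2 * Real.exp (∫ s in a..t, ρ s)) a b := by
    have := (hnac.fun_mul hnac).fun_mul (hρ.absolutelyContinuousOnInterval_primitive).rexp
    simpa only [sq] using this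
  have h₁ : ∀ᵐ t : ℝ, t ≠ a := by simp [ae_iff, measure_singleton]
  have h₂ : ∀ᵐ t : ℝ, t ≠ b := by simp [ae_iff, measure_singleton]
  obtain ⟨C, hC⟩ := hac.const_of_ae_hasDerivAt_zero (by
    filter_upwards [hf.ae_hasDerivAt_integral, hρ.ae_hasDerivAt_integral, h, h₁, h₂]
      with t hft hρt ht hta htb hmem
    have hf' := hft hmem a Set.left_mem_uIcc
    have hρ' := hρt hmem a Set.left_mem_uIcc
    have hφ' : HasDerivAt φ (-f t) t := by
      rw [show φ = fun t => x - ∫ s in a..t, f s from funext hφ]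
      exact hf'.const_sub x
    have hio : t ∈ Set.Ioo a b := by
      rw [Set.uIcc_of_le hab] at hmem
      exact ⟨lt_of_le_of_ne hmem.1 hta.symm, lt_of_le_of_ne hmem.2 htb⟩
    have hd := hφ'.norm_sq.mul hρ'.exp
    convert! hd using 1
    have hre : inner ℝ (φ t) (-f t) = -(inner ℂ (φ t) (f t)).re := by
      rw [inner_neg_right, real_inner_eq_re_inner ℂ]
      rfl
    rw [hre]
    have := ht hio
    linear_combination Real.exp (∫ s in a..t, ρ s) * this)
  have ha := hC a Set.left_mem_uIcc
  have hb := hC b Set.right_mem_uIcc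
  simp only [intervalIntegral.integral_same, Real.exp_zero, mul_one, hφ a, sub_zero] at ha
  exact hb.trans ha.symm

end Energy

namespace PoissonUnravelling

section Rate

variable {E : Type*} [NormedAddCommGroup E] [InnerProductSpace ℂ E] [CompleteSpace E]

omit [CompleteSpace E] in
lemma inner_self_re_eq (v : E) : (inner ℂ v v).re = ‖v‖ ^ 2 := by
  simpa using inner_self_eq_norm_sq (𝕜 := ℂ) v

lemma relRate_mul_norm_sq (L : E →L[ℂ] E) (v : E) :
    relRate L v * ‖v‖ ^ 2 = 2 * (inner ℂ v (L v)).re + ‖L v‖ ^ 2 := by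
  have h1 : (inner ℂ v (ContinuousLinearMap.adjoint L v)).re = (inner ℂ v (L v)).re := by
    rw [ContinuousLinearMap.adjoint_inner_right, ← inner_conj_symm, Complex.conj_re]
  have h2 : (inner ℂ v (ContinuousLinearMap.adjoint L (L v))).re = ‖L v‖ ^ 2 := by
    rw [ContinuousLinearMap.adjoint_inner_right, inner_self_re_eq]
  by_cases hv : v = 0
  · simp [hv]
  · have : ‖v‖ ^ 2 ≠ 0 := pow_ne_zero _ (norm_ne_zero_iff.2 hv)
    rw [relRate, inner_self_re_eq, div_mul_cancel₀ _ this, inner_add_right, inner_add_right,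
      Complex.add_re, Complex.add_re, h1, h2]
    ring

lemma norm_add_apply_sq (L : E →L[ℂ] E) (v : E) :
    ‖v + L v‖ ^ 2 = (1 + relRate L v) * ‖v‖ ^ 2 := by
  have := norm_add_sq (𝕜 := ℂ) v (L v)
  rw [add_mul, relRate_mul_norm_sq, this]
  simp
  ring

lemma one_add_relRate_nonneg (L : E →L[ℂ] E) (v : E) : 0 ≤ 1 + relRate L v := by
  by_cases hv : v = 0
  · simp [hv, relRate]
  · have h0 : 0 < ‖v‖ ^ 2 := pow_pos (norm_pos_iff.2 hv) 2
    have := norm_add_apply_sq L v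
    exact nonneg_of_mul_nonneg_left (this ▸ sq_nonneg _) h0

lemma abs_relRate_le (L : E →L[ℂ] E) (v : E) : |relRate L v| ≤ 2 * ‖L‖ + ‖L‖ ^ 2 := by
  by_cases hv : v = 0
  · simp [hv, relRate]; positivity
  · have h0 : 0 < ‖v‖ ^ 2 := pow_pos (norm_pos_iff.2 hv) 2
    have hL : ‖L v‖ ≤ ‖L‖ * ‖v‖ := L.le_opNorm v
    have hi : |(inner ℂ v (L v)).re| ≤ ‖L‖ * ‖v‖ ^ 2 :=
      (Complex.abs_re_le_norm _).trans <| (norm_inner_le_norm v (L v)).trans <| by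
        nlinarith [norm_nonneg v]
    have hs : ‖L v‖ ^ 2 ≤ ‖L‖ ^ 2 * ‖v‖ ^ 2 := by
      rw [← mul_pow]; exact pow_le_pow_left₀ (norm_nonneg _) hL 2
    have hm := relRate_mul_norm_sq L v
    refine le_of_mul_le_mul_right ?_ h0
    rw [← abs_of_pos h0, ← abs_mul, abs_of_pos h0, hm]
    refine (abs_add_le _ _).trans ?_
    rw [abs_mul, abs_of_nonneg (sq_nonneg ‖L v‖)]
    norm_num
    linarith

lemma re_inner_I_smul_applyOp {H : E →ₗ.[ℂ] E} (hH : IsSelfAdjoint H) {v : E}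
    (hv : v ∈ H.domain) : (inner ℂ v (Complex.I • applyOp H v)).re = 0 := by
  have hfa := LinearPMap.adjoint_isFormalAdjoint hH.dense_domain
  rw [LinearPMap.isSelfAdjoint_def.1 hH] at hfa
  have h := hfa ⟨v, hv⟩ ⟨v, hv⟩
  simp only at h
  rw [applyOp, dif_pos hv, inner_smul_right]
  rw [← inner_conj_symm] at h
  have him := Complex.conj_eq_iff_im.1 h
  simp [him]

variable {ι : Type*} [Fintype ι]

lemma two_re_inner_drift_add {H : E →ₗ.[ℂ] E} (hH : IsSelfAdjoint H) (L : ι → E →L[ℂ] E) {v : E}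
    (hv : v ∈ H.domain) :
    2 * (inner ℂ v (drift H L v + ∑ α, L α v)).re = (∑ α, relRate (L α) v) * ‖v‖ ^ 2 := by
  rw [drift, inner_add_right, inner_add_right, Complex.add_re, Complex.add_re,
    re_inner_I_smul_applyOp hH hv, inner_smul_right, inner_sum, inner_sum, Finset.sum_mul]
  simp_rw [relRate_mul_norm_sq, ContinuousLinearMap.adjoint_inner_right]
  rw [show (1 / 2 : ℂ) = ((1 / 2 : ℝ) : ℂ) by norm_num, Complex.re_ofReal_mul, Complex.re_sum,
    Complex.re_sum, Finset.sum_add_distrib, ← Finset.mul_sum]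
  simp_rw [inner_self_re_eq]
  ring

end Rate

section CadlagPath

variable {F : Type*} [NormedAddCommGroup F] {ψ : ℝ≥0 → F}

lemma stronglyMeasurable_leftLim (hl : ∀ t, ∃ l, Tendsto ψ (𝓝[<] t) (𝓝 l)) :
    StronglyMeasurable (Function.leftLim ψ) := by
  refine stronglyMeasurable_of_tendsto atTop
    (f := fun (k : ℕ) (s : ℝ≥0) => ψ (((⌈((k : ℝ≥0) + 1) * s⌉₊ - 1 : ℕ) : ℝ≥0) / (k + 1)))
    (fun k => ?_) (tendsto_pi_nhds.2 fun s => ?_)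
  · have h1 : StronglyMeasurable fun j : ℕ => ψ (((j - 1 : ℕ) : ℝ≥0) / (k + 1)) :=
      StronglyMeasurable.of_discrete
    exact h1.comp_measurable (Nat.measurable_ceil.comp (measurable_const.mul measurable_id))
  · rcases eq_or_ne s 0 with rfl | hs
    · rw [leftLim_eq_of_isBot (a := (0 : ℝ≥0)) fun _ => zero_le]
      simp
    · refine (tendsto_leftLim_of_tendsto (hl s)).comp ?_
      have hs' : 0 < s := pos_iff_ne_zero.2 hs
      have hlt : ∀ k : ℕ, ((⌈((k : ℝ≥0) + 1) * s⌉₊ - 1 : ℕ) : ℝ≥0) / (k + 1) < s := fun k => by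
        rw [div_lt_iff₀ (by positivity), mul_comm s]
        apply Nat.lt_ceil.1
        have : 0 < ⌈((k : ℝ≥0) + 1) * s⌉₊ := Nat.ceil_pos.2 (by positivity)
        omega
      refine tendsto_nhdsWithin_iff.2 ⟨?_, Eventually.of_forall hlt⟩
      refine tendsto_of_tendsto_of_tendsto_of_le_of_le
        (g := fun k : ℕ => s - 1 / ((k : ℝ≥0) + 1)) ?_ tendsto_const_nhds ?_ fun k => (hlt k).le
      · have h0 : Tendsto (fun k : ℕ => 1 / ((k : ℝ≥0) + 1)) atTop (𝓝 0) :=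
          tendsto_one_div_add_atTop_nhds_zero_nat
        simpa using tendsto_const_nhds.sub h0
      · intro k
        simp only
        rw [tsub_le_iff_right, ← add_div, le_div_iff₀ (by positivity), mul_comm]
        refine (Nat.le_ceil _).trans ?_
        have : ⌈((k : ℝ≥0) + 1) * s⌉₊ ≤ ⌈((k : ℝ≥0) + 1) * s⌉₊ - 1 + 1 := by omega
        exact_mod_cast this

lemma exists_norm_le_of_cadlag (hr : ∀ t, ContinuousWithinAt ψ (Set.Ici t) t)
    (hl : ∀ t, ∃ l, Tendsto ψ (𝓝[<] t) (𝓝 l)) (T : ℝ≥0) : ∃ C, ∀ s ≤ T, ‖ψ s‖ ≤ C := by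
  have hb : Bornology.IsBounded (ψ '' Set.Icc 0 T) := by
    refine isCompact_Icc.induction_on (p := fun s => Bornology.IsBounded (ψ '' s)) (by simp)
      (fun s t hst ht => ht.subset (Set.image_mono hst)) (fun s t hs ht => ?_) fun u _ => ?_
    · rw [Set.image_union]; exact hs.union ht
    · obtain ⟨l, hl⟩ := hl u
      have h1 : ψ ⁻¹' Metric.ball l 1 ∈ 𝓝[<] u := hl (Metric.ball_mem_nhds _ one_pos)
      have h2 : ψ ⁻¹' Metric.ball (ψ u) 1 ∈ 𝓝[≥] u := hr u (Metric.ball_mem_nhds _ one_pos)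
      refine ⟨ψ ⁻¹' (Metric.ball l 1 ∪ Metric.ball (ψ u) 1), mem_nhdsWithin_of_mem_nhds ?_, ?_⟩
      · rw [← nhdsLT_sup_nhdsGE]
        exact ⟨mem_of_superset h1 fun x hx => Or.inl hx, mem_of_superset h2 fun x hx => Or.inr hx⟩
      · exact (Metric.isBounded_ball.union Metric.isBounded_ball).subset
          (Set.image_preimage_subset _ _)
  obtain ⟨C, hC⟩ := hb.exists_norm_le
  exact ⟨C, fun s hs => hC _ ⟨s, ⟨zero_le, hs⟩, rfl⟩⟩

lemma norm_leftLim_le (hl : ∀ t, ∃ l, Tendsto ψ (𝓝[<] t) (𝓝 l)) {C : ℝ} {T : ℝ≥0}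
    (hC : ∀ s ≤ T, ‖ψ s‖ ≤ C) {s : ℝ≥0} (hs : s ≤ T) : ‖Function.leftLim ψ s‖ ≤ C := by
  rcases eq_or_neBot (𝓝[<] s) with h | h
  · rw [leftLim_eq_of_eq_bot _ h]; exact hC s hs
  · refine le_of_tendsto (tendsto_leftLim_of_tendsto (hl s)).norm ?_
    filter_upwards [self_mem_nhdsWithin] with u hu using hC u ((le_of_lt hu).trans hs)

lemma timeIntegrable_of_bounded {g : ℝ≥0 → F} (hg : StronglyMeasurable g) {C : ℝ} {t : ℝ≥0}
    (hC : ∀ s ≤ t, ‖g s‖ ≤ C) : TimeIntegrable g t := by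
  have hm : StronglyMeasurable fun s : ℝ => g s.toNNReal :=
    hg.comp_measurable measurable_real_toNNReal
  refine (intervalIntegrable_const (c := C)).mono_fun hm.aestronglyMeasurable ?_
  rw [Set.uIoc_of_le t.coe_nonneg]
  refine (ae_restrict_iff' measurableSet_Ioc).2 (Eventually.of_forall fun s hs => ?_)
  exact (hC _ (Real.toNNReal_le_iff_le_coe.2 hs.2)).trans (le_abs_self C)

end CadlagPath

section TimeIntegral

variable {F : Type*} [NormedAddCommGroup F]

lemma TimeIntegrable.mono {g : ℝ≥0 → F} {s t : ℝ≥0} (hg : TimeIntegrable g t) (hst : s ≤ t) :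
    TimeIntegrable g s :=
  IntervalIntegrable.mono_set hg (Set.uIcc_subset_uIcc_left
    (by rw [Set.uIcc_of_le t.coe_nonneg]; exact ⟨s.2, hst⟩))

variable [NormedSpace ℝ F]

lemma timeIntegral_add {f g : ℝ≥0 → F} {t : ℝ≥0} (hf : TimeIntegrable f t)
    (hg : TimeIntegrable g t) :
    timeIntegral (fun s => f s + g s) t = timeIntegral f t + timeIntegral g t :=
  intervalIntegral.integral_add hf hg

lemma timeIntegral_sum {ι : Type*} {g : ι → ℝ≥0 → F} (u : Finset ι) {t : ℝ≥0}
    (hg : ∀ α ∈ u, TimeIntegrable (g α) t) :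
    timeIntegral (fun s => ∑ α ∈ u, g α s) t = ∑ α ∈ u, timeIntegral (g α) t :=
  intervalIntegral.integral_finsetSum hg

omit [NormedSpace ℝ F] in
lemma TimeIntegrable.sum {ι : Type*} {g : ι → ℝ≥0 → F} (u : Finset ι) {t : ℝ≥0}
    (hg : ∀ α ∈ u, TimeIntegrable (g α) t) : TimeIntegrable (fun s => ∑ α ∈ u, g α s) t := by
  have := IntervalIntegrable.sum u hg
  unfold TimeIntegrable
  convert! this using 1
  ext s
  simp

lemma tendsto_timeIntegral_left {g : ℝ≥0 → F} {t : ℝ≥0} (hg : TimeIntegrable g t) :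
    Tendsto (timeIntegral g) (𝓝[<] t) (𝓝 (timeIntegral g t)) := by
  have hc : ContinuousOn (fun x : ℝ => ∫ s in (0 : ℝ)..x, g s.toNNReal) (Set.uIcc 0 t) :=
    intervalIntegral.continuousOn_primitive_interval (by
      rw [Set.uIcc_of_le t.coe_nonneg, integrableOn_Icc_iff_integrableOn_Ioc]
      exact (intervalIntegrable_iff_integrableOn_Ioc_of_le t.coe_nonneg).1 hg)
  refine (hc t Set.right_mem_uIcc).tendsto.comp (tendsto_nhdsWithin_iff.2 ⟨?_, ?_⟩)
  · exact (NNReal.continuous_coe.tendsto t).mono_left nhdsWithin_le_nhds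
  · filter_upwards [self_mem_nhdsWithin] with s hs
    rw [Set.uIcc_of_le t.coe_nonneg]
    exact ⟨s.2, NNReal.coe_le_coe.2 (le_of_lt hs)⟩

end TimeIntegral

section Jumps

@[to_additive]
lemma finprod_mem_Ioc_eq_mul {M : Type*} [CommMonoid M] {f : ℝ≥0 → M} {a t : ℝ≥0} (hat : a < t)
    (hfin : (Set.Ioc 0 t ∩ Function.mulSupport f).Finite) (h : ∀ s ∈ Set.Ioo a t, f s = 1) :
    ∏ᶠ s ∈ Set.Ioc 0 t, f s = (∏ᶠ s ∈ Set.Ioc 0 a, f s) * f t := by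
  have hsub : Set.Ioc 0 t = Set.Ioc 0 a ∪ Set.Ioc a t :=
    (Set.Ioc_union_Ioc_eq_Ioc zero_le hat.le).symm
  have h2 : ∏ᶠ s ∈ Set.Ioc a t, f s = f t := by
    rw [← finprod_mem_singleton (a := t) (f := f)]
    refine finprod_mem_inter_mulSupport_eq' f _ _ fun s hs => ⟨fun hm => ?_, fun hm => ?_⟩
    · by_contra hne
      exact hs (h s ⟨hm.1, lt_of_le_of_ne hm.2 hne⟩)
    · rw [Set.mem_singleton_iff.1 hm]; exact ⟨hat, le_rfl⟩
  rw [hsub, finprod_mem_union' (Set.disjoint_left.2 fun s h1 h2 => not_lt.2 h1.2 h2.1), h2]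
  · exact hfin.subset (Set.inter_subset_inter_left _ (hsub ▸ Set.subset_union_left))
  · exact hfin.subset (Set.inter_subset_inter_left _ (hsub ▸ Set.subset_union_right))

lemma finite_jumps {n : ℝ≥0 → ℕ} (hn : Monotone n) (t : ℝ≥0) :
    {s | s ∈ Set.Ioc 0 t ∧ jump n s ≠ 0}.Finite := by
  refine Set.Finite.of_finite_image (f := n) ((Set.finite_Iic (n t)).subset ?_) ?_
  · rintro _ ⟨s, hs, rfl⟩
    exact hn hs.1.2
  · have hlt : ∀ s u, s < u → jump n u ≠ 0 → n s < n u := fun s u hsu hu =>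
      (hn.le_leftLim hsu).trans_lt (by unfold jump at hu; omega)
    intro s hs u hu heq
    rcases lt_trichotomy s u with h | h | h
    · exact absurd heq (hlt s u h hu.2).ne
    · exact h
    · exact absurd heq (hlt u s h hs.2).ne'

lemma exists_lt_forall_Ioo_notMem {S : Set ℝ≥0} {t : ℝ≥0} (ht : 0 < t)
    (hS : (S ∩ Set.Ioo 0 t).Finite) : ∃ a < t, (a ∈ S ∩ Set.Ioo 0 t ∨ a = 0) ∧
      ∀ s ∈ Set.Ioo a t, s ∉ S := by
  have hfin : (insert 0 (S ∩ Set.Ioo 0 t)).Finite := hS.insert 0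
  obtain ⟨a, ha, hmax⟩ := hfin.exists_maximal ⟨0, Set.mem_insert _ _⟩
  refine ⟨a, ?_, ?_, fun s hs hmem => ?_⟩
  · rcases ha with rfl | ha
    exacts [ht, ha.2.2]
  · rcases ha with rfl | ha
    exacts [Or.inr rfl, Or.inl ha]
  · have := hmax (Set.mem_insert_of_mem _ ⟨hmem, zero_le.trans_lt hs.1, hs.2⟩) hs.1.le
    exact absurd hs.1 (not_lt.2 this)

variable {ι : Type*} {n : ι → ℝ≥0 → ℕ}

/-- The times at which some component of `n` jumps. -/
def jumpSet (n : ι → ℝ≥0 → ℕ) : Set ℝ≥0 := {s | ∃ α, jump (n α) s ≠ 0}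

lemma jump_eq_zero_of_notMem {s : ℝ≥0} (hs : s ∉ jumpSet n) (α : ι) : jump (n α) s = 0 := by
  by_contra h
  exact hs ⟨α, h⟩

variable [Fintype ι]

lemma finite_jumpSet (hn : ∀ α, Monotone (n α)) (t : ℝ≥0) : (jumpSet n ∩ Set.Ioc 0 t).Finite := by
  refine (Set.finite_iUnion fun α => finite_jumps (hn α) t).subset ?_
  rintro s ⟨⟨α, hα⟩, hs⟩
  exact Set.mem_iUnion.2 ⟨α, hs, hα⟩

@[to_additive]
lemma finprod_mem_Ioc_eq_prod {M : Type*} [CommMonoid M] (hn : ∀ α, Monotone (n α))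
    {f : ℝ≥0 → M} {t : ℝ≥0} (hf : ∀ s, s ∈ Set.Ioc 0 t → s ∉ jumpSet n → f s = 1) :
    ∏ᶠ s ∈ Set.Ioc 0 t, f s = ∏ s ∈ (finite_jumpSet hn t).toFinset, f s := by
  refine finprod_mem_eq_prod_of_inter_mulSupport_eq _ ?_
  ext s
  simp only [Set.mem_inter_iff, Function.mem_mulSupport, Set.Finite.coe_toFinset]
  refine ⟨fun h => ⟨⟨?_, h.1⟩, h.2⟩, fun h => ⟨h.1.2, h.2⟩⟩
  by_contra hs
  exact h.2 (hf s h.1 hs)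

/-- At any positive time at most one component jumps, and its jump has size one. -/
lemma IsSimpleFamily.jump_cases (hn : IsSimpleFamily n) {s : ℝ≥0} (hs : 0 < s) :
    (∀ α, jump (n α) s = 0) ∨
      ∃ α, jump (n α) s = 1 ∧ ∀ β, β ≠ α → jump (n β) s = 0 := by
  by_cases h : ∀ α, jump (n α) s = 0
  · exact Or.inl h
  · push Not at h
    obtain ⟨α, hα⟩ := h
    have := hn.jump_le_one α s hs
    exact Or.inr ⟨α, by omega, fun β hβ => hn.no_common_jump α β hβ.symm s hs hα⟩

end Jumps

end PoissonUnravelling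

namespace PoissonUnravelling

section CompInt

variable {ι F : Type*} [NormedAddCommGroup F] [NormedSpace ℝ F]

omit [NormedSpace ℝ F] in
/-- Over a time interval without interior jumps the sum over jumps grows by the last jump. -/
lemma finsum_jump_eq_add {n : ℝ≥0 → ℕ} (hn : Monotone n) (g : ℝ≥0 → F) {a t : ℝ≥0} (hat : a < t)
    (h : ∀ s ∈ Set.Ioo a t, jump n s = 0) :
    ∑ᶠ s ∈ Set.Ioc 0 t, jump n s • g s = ∑ᶠ s ∈ Set.Ioc 0 a, jump n s • g s + jump n t • g t := by
  refine finsum_mem_Ioc_eq_add hat ((finite_jumps hn t).subset ?_) fun s hs => by simp [h s hs]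
  exact fun s hs => ⟨hs.1, fun h0 => hs.2 (by simp [h0])⟩

lemma compInt_eq_of_jumpFree {n : ℝ≥0 → ℕ} (hn : Monotone n) {g : ℝ≥0 → F} {a t : ℝ≥0} (hat : a < t)
    (h : ∀ s ∈ Set.Ioo a t, jump n s = 0) :
    compInt n g t = compInt n g a + jump n t • g t - (timeIntegral g t - timeIntegral g a) := by
  rw [compInt, compInt, finsum_jump_eq_add hn g hat h]
  abel

lemma tendsto_compInt_left {n : ℝ≥0 → ℕ} (hn : Monotone n) {g : ℝ≥0 → F} {t : ℝ≥0} (ht : 0 < t)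
    (hg : TimeIntegrable g t) :
    Tendsto (compInt n g) (𝓝[<] t) (𝓝 (compInt n g t - jump n t • g t)) := by
  obtain ⟨a, hat, -, ha⟩ := exists_lt_forall_Ioo_notMem (S := {s | jump n s ≠ 0}) ht
    ((finite_jumps hn t).subset fun s hs => ⟨⟨hs.2.1, hs.2.2.le⟩, hs.1⟩)
  have ha' : ∀ s ∈ Set.Ioo a t, jump n s = 0 := fun s hs => not_not.1 (ha s hs)
  have heq : ∀ u ∈ Set.Ioo a t, compInt n g a + timeIntegral g a - timeIntegral g u =
      compInt n g u := fun u hu => by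
    rw [compInt_eq_of_jumpFree hn hu.1 fun s hs => ha' s ⟨hs.1, hs.2.trans hu.2⟩, ha' u hu, zero_smul]
    abel
  have hlim : compInt n g t - jump n t • g t =
      compInt n g a + timeIntegral g a - timeIntegral g t := by
    rw [compInt_eq_of_jumpFree hn hat ha']
    abel
  rw [hlim]
  refine (tendsto_const_nhds.sub (tendsto_timeIntegral_left hg)).congr' ?_
  filter_upwards [Ioo_mem_nhdsLT hat] with u hu using heq u hu

variable [Fintype ι]

lemma leftLim_sum_compInt {n : ι → ℝ≥0 → ℕ} (hn : ∀ α, Monotone (n α)) {g : ι → ℝ≥0 → F}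
    {t : ℝ≥0} (ht : 0 < t) (hg : ∀ α, TimeIntegrable (g α) t) :
    Function.leftLim (fun u => ∑ α, compInt (n α) (g α) u) t =
      ∑ α, compInt (n α) (g α) t - ∑ α, jump (n α) t • g α t := by
  have : (𝓝[<] t).NeBot := nhdsLT_neBot_of_exists_lt ⟨0, ht⟩
  refine leftLim_eq_of_tendsto ?_
  rw [← Finset.sum_sub_distrib]
  exact tendsto_finsetSum _ fun α _ => tendsto_compInt_left (hn α) ht (hg α)

end CompInt

section Normalizer

variable {ι : Type*} [Fintype ι] {n : ι → ℝ≥0 → ℕ}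

lemma normalizer_eq (hn : IsSimpleFamily n) {r c : ι → ℝ≥0 → ℝ} {t : ℝ≥0}
    (hr : ∀ α, TimeIntegrable (r α) t) (hc : ∀ α, TimeIntegrable (c α) t) :
    normalizer n r c t = Real.exp (1 / 2 * timeIntegral (fun s => ∑ α, r α s) t) *
      ∏ᶠ s ∈ Set.Ioc 0 t, ∏ α, c α s ^ jump (n α) s := by
  have hc1 : ∀ α, TimeIntegrable (fun s => c α s - 1) t := fun α =>
    (hc α).sub intervalIntegrable_const
  set X : ℝ≥0 → ℝ := fun u => ∑ α, compInt (n α) (fun s => c α s - 1) u with hX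
  have hX0 : X 0 = 0 := by
    simp only [hX, compInt, Set.Ioc_self, finsum_mem_empty]
    simp [timeIntegral]
  have hjump : ∀ s ∈ Set.Ioc 0 t,
      X s - Function.leftLim X s = ∑ α, jump (n α) s • (c α s - 1) := fun s hs => by
    rw [hX, leftLim_sum_compInt hn.mono hs.1 fun α => (hc1 α).mono hs.2]
    simp only [sub_sub_cancel]
  have hfactor : ∀ s ∈ Set.Ioc 0 t,
      1 + ∑ α, jump (n α) s • (c α s - 1) = ∏ α, c α s ^ jump (n α) s := fun s hs => by
    rcases hn.jump_cases hs.1 with h | ⟨α, hα, h⟩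
    · simp [h]
    · rw [Finset.sum_eq_single α (fun β _ hβ => by simp [h β hβ]) (by simp),
        Finset.prod_eq_single α (fun β _ hβ => by simp [h β hβ]) (by simp), hα]
      simp
  have hXt : X t = ∑ s ∈ (finite_jumpSet hn.mono t).toFinset, ∑ α, jump (n α) s • (c α s - 1) -
      ∑ α, timeIntegral (fun s => c α s - 1) t := by
    simp only [hX, compInt]
    rw [Finset.sum_sub_distrib, Finset.sum_comm]
    congr 1
    refine Finset.sum_congr rfl fun α _ => ?_
    exact finsum_mem_Ioc_eq_sum hn.mono fun s _ hs => by simp [jump_eq_zero_of_notMem hs α]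
  have hprod : doleansDade X t = Real.exp (-∑ α, timeIntegral (fun s => c α s - 1) t) *
      ∏ᶠ s ∈ Set.Ioc 0 t, ∏ α, c α s ^ jump (n α) s := by
    have h1 : ∏ᶠ s ∈ Set.Ioc 0 t, (1 + (X s - Function.leftLim X s)) *
          Real.exp (-(X s - Function.leftLim X s)) =
        ∏ᶠ s ∈ Set.Ioc 0 t, (∏ α, c α s ^ jump (n α) s) *
          Real.exp (-∑ α, jump (n α) s • (c α s - 1)) :=
      finprod_mem_congr rfl fun s hs => by rw [hjump s hs, hfactor s hs]
    rw [doleansDade, h1, finprod_mem_Ioc_eq_prod hn.mono fun s _ hs => by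
        simp [jump_eq_zero_of_notMem hs],
      finprod_mem_Ioc_eq_prod hn.mono fun s _ hs => by simp [jump_eq_zero_of_notMem hs],
      Finset.prod_mul_distrib, ← Real.exp_sum, hX0, hXt, mul_comm (∏ s ∈ _, _), ← mul_assoc,
      ← Real.exp_add, Finset.sum_neg_distrib]
    congr 2
    ring
  rw [normalizer, hprod, ← mul_assoc, ← Real.exp_add]
  congr 2
  rw [timeIntegral_sum _ fun α _ => hr α, Finset.mul_sum, ← Finset.sum_neg_distrib,
    ← Finset.sum_add_distrib]
  refine Finset.sum_congr rfl fun α _ => ?_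
  have hI : ∀ f : ℝ≥0 → ℝ, timeIntegral f t = ∫ s in (0 : ℝ)..t, f s.toNNReal := fun _ => rfl
  have h1 : timeIntegral (fun s => 1 / 2 * (r α s - 2) + c α s) t =
      1 / 2 * timeIntegral (r α) t - t + timeIntegral (c α) t := by
    have hr2 : TimeIntegrable (fun s => 1 / 2 * (r α s - 2)) t :=
      IntervalIntegrable.const_mul ((hr α).sub intervalIntegrable_const) (1 / 2)
    rw [timeIntegral_add hr2 (hc α), hI (fun s => 1 / 2 * (r α s - 2)),
      intervalIntegral.integral_const_mul,
      intervalIntegral.integral_sub (hr α) intervalIntegrable_const]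
    simp [hI]
    ring
  have h2 : timeIntegral (fun s => c α s - 1) t = timeIntegral (c α) t - t := by
    rw [hI, intervalIntegral.integral_sub (hc α) intervalIntegrable_const]
    simp [hI]
  rw [h1, h2]
  ring

end Normalizer

section Solution

variable {E ι : Type*} [Fintype ι] [NormedAddCommGroup E] [InnerProductSpace ℂ E] [CompleteSpace E]
  {n : ι → ℝ≥0 → ℕ} {H : E →ₗ.[ℂ] E} {L : ι → E →L[ℂ] E} {φ₀ : E} {ψ : ℝ≥0 → E}

lemma IsSolutionPath.stronglyMeasurable_rate (hψ : IsSolutionPath n H L φ₀ ψ) (α : ι) :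
    StronglyMeasurable (rate L ψ α) := by
  have h := stronglyMeasurable_leftLim hψ.leftLimit
  have hc : ∀ A : E →L[ℂ] E, StronglyMeasurable fun s => A (Function.leftLim ψ s) := fun A =>
    A.continuous.comp_stronglyMeasurable h
  have h1 := h.inner (𝕜 := ℂ) (((hc (L α)).add (hc (ContinuousLinearMap.adjoint (L α)))).add
    (hc ((ContinuousLinearMap.adjoint (L α)).comp (L α))))
  have h2 := h.inner (𝕜 := ℂ) h
  exact ((Complex.continuous_re.comp_stronglyMeasurable h1).measurable.div
    (Complex.continuous_re.comp_stronglyMeasurable h2).measurable).stronglyMeasurable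

lemma IsSolutionPath.timeIntegrable_rate (hψ : IsSolutionPath n H L φ₀ ψ) (α : ι) (t : ℝ≥0) :
    TimeIntegrable (rate L ψ α) t :=
  timeIntegrable_of_bounded (hψ.stronglyMeasurable_rate α) fun s _ =>
    abs_relRate_le (L α) (Function.leftLim ψ s)

lemma IsSolutionPath.timeIntegrable_apply_leftLim (hψ : IsSolutionPath n H L φ₀ ψ) (α : ι)
    (t : ℝ≥0) : TimeIntegrable (fun s => L α (Function.leftLim ψ s)) t := by
  obtain ⟨C, hC⟩ := exists_norm_le_of_cadlag hψ.rightCont hψ.leftLimit t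
  refine timeIntegrable_of_bounded (C := ‖L α‖ * C)
    ((L α).continuous.comp_stronglyMeasurable (stronglyMeasurable_leftLim hψ.leftLimit))
    fun s hs => ?_
  exact (L α).le_of_opNorm_le_of_le le_rfl (norm_leftLim_le hψ.leftLimit hC hs)

/-- The total drift of the equation, including the compensators. -/
noncomputable def totalDrift (H : E →ₗ.[ℂ] E) (L : ι → E →L[ℂ] E) (ψ : ℝ≥0 → E) (s : ℝ≥0) : E :=
  drift H L (ψ s) + ∑ α, L α (Function.leftLim ψ s)

lemma IsSolutionPath.timeIntegrable_totalDrift (hψ : IsSolutionPath n H L φ₀ ψ) (t : ℝ≥0) :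
    TimeIntegrable (totalDrift H L ψ) t :=
  IntervalIntegrable.add (hψ.integrable t)
    (TimeIntegrable.sum _ fun α _ => hψ.timeIntegrable_apply_leftLim α t)

lemma IsSolutionPath.eq_sub_timeIntegral (hψ : IsSolutionPath n H L φ₀ ψ) (t : ℝ≥0) :
    ψ t = φ₀ + ∑ α, ∑ᶠ s ∈ Set.Ioc 0 t, jump (n α) s • L α (Function.leftLim ψ s) -
      timeIntegral (totalDrift H L ψ) t := by
  have h : timeIntegral (totalDrift H L ψ) t = timeIntegral (fun s => drift H L (ψ s)) t +
      ∑ α, timeIntegral (fun s => L α (Function.leftLim ψ s)) t := by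
    rw [← timeIntegral_sum _ fun α _ => hψ.timeIntegrable_apply_leftLim α t]
    exact timeIntegral_add (hψ.integrable t)
      (TimeIntegrable.sum _ fun α _ => hψ.timeIntegrable_apply_leftLim α t)
  rw [h, hψ.eq t]
  simp only [compInt, Finset.sum_sub_distrib]
  abel

lemma IsSolutionPath.apply_zero (hψ : IsSolutionPath n H L φ₀ ψ) : ψ 0 = φ₀ := by
  rw [hψ.eq_sub_timeIntegral]
  simp [timeIntegral]

lemma IsSolutionPath.eq_of_jumpFree (hψ : IsSolutionPath n H L φ₀ ψ)
    (hn : ∀ α, Monotone (n α)) {a t : ℝ≥0} (hat : a < t) (h : ∀ s ∈ Set.Ioo a t, s ∉ jumpSet n) :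
    ψ t = ψ a - (timeIntegral (totalDrift H L ψ) t - timeIntegral (totalDrift H L ψ) a) +
      ∑ α, jump (n α) t • L α (Function.leftLim ψ t) := by
  rw [hψ.eq_sub_timeIntegral t, hψ.eq_sub_timeIntegral a]
  simp_rw [fun α => finsum_jump_eq_add (hn α) (fun s => L α (Function.leftLim ψ s)) hat
    fun s hs => jump_eq_zero_of_notMem (h s hs) α]
  rw [Finset.sum_add_distrib]
  abel

lemma IsSolutionPath.leftLim_eq_of_jumpFree (hψ : IsSolutionPath n H L φ₀ ψ)
    (hn : ∀ α, Monotone (n α)) {a t : ℝ≥0} (hat : a < t) (h : ∀ s ∈ Set.Ioo a t, s ∉ jumpSet n) :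
    Function.leftLim ψ t =
      ψ a - (timeIntegral (totalDrift H L ψ) t - timeIntegral (totalDrift H L ψ) a) := by
  have : (𝓝[<] t).NeBot := nhdsLT_neBot_of_exists_lt ⟨a, hat⟩
  refine leftLim_eq_of_tendsto ((tendsto_const_nhds.sub
    ((tendsto_timeIntegral_left (hψ.timeIntegrable_totalDrift t)).sub
      tendsto_const_nhds)).congr' ?_)
  filter_upwards [Ioo_mem_nhdsLT hat] with u hu
  rw [hψ.eq_of_jumpFree hn hu.1 fun s hs => h s ⟨hs.1, hs.2.trans hu.2⟩]
  simp [jump_eq_zero_of_notMem (h u hu)]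

lemma IsSolutionPath.apply_eq_leftLim_add (hψ : IsSolutionPath n H L φ₀ ψ)
    (hn : ∀ α, Monotone (n α)) {a t : ℝ≥0} (hat : a < t) (h : ∀ s ∈ Set.Ioo a t, s ∉ jumpSet n) :
    ψ t = Function.leftLim ψ t + ∑ α, jump (n α) t • L α (Function.leftLim ψ t) := by
  conv_lhs => rw [hψ.eq_of_jumpFree hn hat h, ← hψ.leftLim_eq_of_jumpFree hn hat h]

/-- Norm evolution over a jump-free time interval, up to the left limit at its end. -/
lemma IsSolutionPath.norm_sq_leftLim (hψ : IsSolutionPath n H L φ₀ ψ) (hH : IsSelfAdjoint H)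
    (hn : ∀ α, Monotone (n α)) {a t : ℝ≥0} (hat : a < t) (h : ∀ s ∈ Set.Ioo a t, s ∉ jumpSet n) :
    ‖Function.leftLim ψ t‖ ^ 2 * Real.exp (timeIntegral (fun s => ∑ α, rate L ψ α s) t) =
      ‖ψ a‖ ^ 2 * Real.exp (timeIntegral (fun s => ∑ α, rate L ψ α s) a) := by
  have hf := hψ.timeIntegrable_totalDrift t
  have hρ : TimeIntegrable (fun s => ∑ α, rate L ψ α s) t :=
    TimeIntegrable.sum _ fun α _ => hψ.timeIntegrable_rate α t
  have hsub : Set.uIcc (a : ℝ) t ⊆ Set.uIcc 0 t :=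
    Set.uIcc_subset_uIcc_right (by
      rw [Set.uIcc_of_le t.coe_nonneg]; exact ⟨a.coe_nonneg, hat.le⟩)
  set φ : ℝ → E := fun u => ψ a - ∫ s in (a : ℝ)..u, totalDrift H L ψ s.toNNReal with hφ
  have hadd : ∀ u : ℝ≥0, u ≤ t → ∫ s in (a : ℝ)..u, totalDrift H L ψ s.toNNReal =
      timeIntegral (totalDrift H L ψ) u - timeIntegral (totalDrift H L ψ) a := fun u hu =>
    (intervalIntegral.integral_interval_sub_left (hf.mono hu) (hf.mono hat.le)).symm
  have hleft : ∀ u : ℝ≥0, a < u → u ≤ t → Function.leftLim ψ u = φ u := fun u hau hut => by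
    rw [hψ.leftLim_eq_of_jumpFree hn hau fun s hs => h s ⟨hs.1, hs.2.trans_le hut⟩, hφ]
    simp only [hadd u hut]
  have hval : ∀ u ∈ Set.Ioo a t, ψ u = φ u := fun u hu => by
    rw [hψ.apply_eq_leftLim_add hn hu.1 fun s hs => h s ⟨hs.1, hs.2.trans hu.2⟩,
      ← hleft u hu.1 hu.2.le]
    simp [jump_eq_zero_of_notMem (h u hu)]
  have key := norm_sq_mul_exp_integral_eq (f := fun s => totalDrift H L ψ s.toNNReal)
    (φ := φ) (ρ := fun s => ∑ α, rate L ψ α s.toNNReal) (x := ψ a)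
    (NNReal.coe_le_coe.2 hat.le) (hf.mono_set hsub) (hρ.mono_set hsub) (fun _ => rfl) (by
      filter_upwards [hψ.mem_domain] with u hdom hu
      have hu0 : 0 ≤ u := a.coe_nonneg.trans hu.1.le
      lift u to ℝ≥0 using hu0
      have hu' : u ∈ Set.Ioo a t := ⟨NNReal.coe_lt_coe.1 hu.1, NNReal.coe_lt_coe.1 hu.2⟩
      have hd := hdom u.coe_nonneg
      simp only [Real.toNNReal_coe] at hd ⊢
      rw [totalDrift]
      simp only [rate]
      rw [hleft u hu'.1 hu'.2.le, hval u hu'] at *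
      exact two_re_inner_drift_add hH L hd)
  rw [hleft t hat le_rfl, ← key, mul_assoc, ← Real.exp_add]
  congr 2
  have := intervalIntegral.integral_interval_sub_left hρ (hρ.mono hat.le)
  exact (sub_eq_iff_eq_add.1 this)

lemma IsSolutionPath.norm_sq_apply (hψ : IsSolutionPath n H L φ₀ ψ) (hn : IsSimpleFamily n)
    {t : ℝ≥0} (ht : 0 < t) :
    ‖ψ t‖ ^ 2 = ‖Function.leftLim ψ t‖ ^ 2 * ∏ α, (1 + rate L ψ α t) ^ jump (n α) t := by
  obtain ⟨a, hat, -, ha⟩ := exists_lt_forall_Ioo_notMem (S := jumpSet n) ht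
    ((finite_jumpSet hn.mono t).subset (Set.inter_subset_inter_right _ Set.Ioo_subset_Ioc_self))
  rw [hψ.apply_eq_leftLim_add hn.mono hat ha]
  rcases hn.jump_cases ht with h | ⟨α, hα, h⟩
  · simp [h]
  · rw [Finset.sum_eq_single α (fun β _ hβ => by simp [h β hβ]) (by simp),
      Finset.prod_eq_single α (fun β _ hβ => by simp [h β hβ]) (by simp), hα, one_smul, pow_one,
      norm_add_apply_sq, mul_comm]
    rfl

/-- The explicit formula for the norm of a solution of the linear equation. -/
lemma IsSolutionPath.norm_sq_mul_exp (hψ : IsSolutionPath n H L φ₀ ψ) (hH : IsSelfAdjoint H)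
    (hn : IsSimpleFamily n) (t : ℝ≥0) :
    ‖ψ t‖ ^ 2 * Real.exp (timeIntegral (fun s => ∑ α, rate L ψ α s) t) =
      ‖φ₀‖ ^ 2 * ∏ᶠ s ∈ Set.Ioc 0 t, ∏ α, (1 + rate L ψ α s) ^ jump (n α) s := by
  have hfin : ∀ t, (jumpSet n ∩ Set.Ioo 0 t).Finite := fun t =>
    (finite_jumpSet hn.mono t).subset (Set.inter_subset_inter_right _ Set.Ioo_subset_Ioc_self)
  have h0 : ‖ψ 0‖ ^ 2 * Real.exp (timeIntegral (fun s => ∑ α, rate L ψ α s) 0) =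
      ‖φ₀‖ ^ 2 * ∏ᶠ s ∈ Set.Ioc 0 (0 : ℝ≥0), ∏ α, (1 + rate L ψ α s) ^ jump (n α) s := by
    simp [hψ.apply_zero, timeIntegral]
  induction hk : (jumpSet n ∩ Set.Ioo 0 t).ncard using Nat.strong_induction_on generalizing t with
  | _ k ih =>
  rcases eq_or_ne t 0 with rfl | ht
  · exact h0
  have ht : 0 < t := pos_iff_ne_zero.2 ht
  obtain ⟨a, hat, hmem, ha⟩ := exists_lt_forall_Ioo_notMem ht (hfin t)
  have hA : ‖ψ a‖ ^ 2 * Real.exp (timeIntegral (fun s => ∑ α, rate L ψ α s) a) =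
      ‖φ₀‖ ^ 2 * ∏ᶠ s ∈ Set.Ioc 0 a, ∏ α, (1 + rate L ψ α s) ^ jump (n α) s := by
    rcases hmem with hmem | rfl
    · refine ih _ ?_ a rfl
      rw [← hk]
      refine Set.ncard_lt_ncard ⟨?_, fun hsub => ?_⟩ (hfin t)
      · exact Set.inter_subset_inter_right _ (Set.Ioo_subset_Ioo_right hat.le)
      · exact lt_irrefl a (hsub hmem).2.2
    · exact h0
  rw [finprod_mem_Ioc_eq_mul hat ?_ fun s hs => by simp [jump_eq_zero_of_notMem (ha s hs)],
    ← mul_assoc, ← hA, ← hψ.norm_sq_leftLim hH hn.mono hat ha, hψ.norm_sq_apply hn ht]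
  · ring
  · refine (finite_jumpSet hn.mono t).subset fun s hs => ⟨?_, hs.1⟩
    by_contra hs'
    exact hs.2 (by simp [jump_eq_zero_of_notMem hs'])

lemma IsSolutionPath.ne_zero_iff (hψ : IsSolutionPath n H L φ₀ ψ) (hH : IsSelfAdjoint H)
    (hn : IsSimpleFamily n) (hφ₀ : ‖φ₀‖ = 1) (t : ℝ≥0) :
    ψ t ≠ 0 ↔ ∀ α, ∀ s ∈ Set.Ioc 0 t, jump (n α) s ≠ 0 → -1 < rate L ψ α s := by
  have hiff : ψ t ≠ 0 ↔
      ∏ᶠ s ∈ Set.Ioc 0 t, ∏ α, (1 + rate L ψ α s) ^ jump (n α) s ≠ 0 := by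
    have := hψ.norm_sq_mul_exp hH hn t
    rw [hφ₀, one_pow, one_mul] at this
    rw [← this]
    simp [Real.exp_ne_zero]
  rw [hiff, finprod_mem_Ioc_eq_prod hn.mono fun s _ hs => by simp [jump_eq_zero_of_notMem hs],
    Finset.prod_ne_zero_iff]
  simp only [Set.Finite.mem_toFinset, Finset.prod_ne_zero_iff, Finset.mem_univ, true_imp_iff]
  have hpos : ∀ α s, (1 + rate L ψ α s ≠ 0 ↔ -1 < rate L ψ α s) := fun α s => by
    have h0 : 0 ≤ 1 + rate L ψ α s := one_add_relRate_nonneg (L α) (Function.leftLim ψ s)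
    rw [← h0.lt_iff_ne']
    constructor <;> intro h <;> linarith
  constructor
  · intro h α s hs hj
    have := h s ⟨⟨α, hj⟩, hs⟩ α
    exact (hpos α s).1 fun h0 => this (by rw [h0, zero_pow hj])
  · rintro h s ⟨-, hs⟩ α
    by_cases hj : jump (n α) s = 0
    · simp [hj]
    · exact pow_ne_zero _ ((hpos α s).2 (h α s hs hj))

/-- Any integrable coefficients which agree with `coeff` at the jump times normalize `ψ`. -/
lemma IsSolutionPath.normalizer_sq_mul_norm_sq (hψ : IsSolutionPath n H L φ₀ ψ)
    (hH : IsSelfAdjoint H) (hn : IsSimpleFamily n) (hφ₀ : ‖φ₀‖ = 1) {t : ℝ≥0} (hne : ψ t ≠ 0)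
    {c : ι → ℝ≥0 → ℝ} (hc : ∀ α, TimeIntegrable (c α) t)
    (hcoeff : ∀ α, ∀ s ∈ Set.Ioc 0 t, jump (n α) s ≠ 0 → c α s = coeff L ψ α s) :
    normalizer n (rate L ψ) c t ^ 2 * ‖ψ t‖ ^ 2 = 1 := by
  have hpos := (hψ.ne_zero_iff hH hn hφ₀ t).1 hne
  have hq := hψ.norm_sq_mul_exp hH hn t
  rw [hφ₀, one_pow, one_mul,
    finprod_mem_Ioc_eq_prod hn.mono fun s _ hs => by simp [jump_eq_zero_of_notMem hs]] at hq
  rw [normalizer_eq hn (fun α => hψ.timeIntegrable_rate α t) hc,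
    finprod_mem_Ioc_eq_prod hn.mono fun s _ hs => by simp [jump_eq_zero_of_notMem hs],
    mul_pow, ← Real.exp_nat_mul]
  have hexp : ((2 : ℕ) : ℝ) * (1 / 2 * timeIntegral (fun s => ∑ α, rate L ψ α s) t) =
      timeIntegral (fun s => ∑ α, rate L ψ α s) t := by push_cast; ring
  rw [hexp, mul_right_comm, mul_comm (Real.exp _), hq, ← Finset.prod_pow, ← Finset.prod_mul_distrib]
  refine Finset.prod_eq_one fun s hs => ?_
  rw [Set.Finite.mem_toFinset] at hs
  rw [← Finset.prod_pow, ← Finset.prod_mul_distrib]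
  refine Finset.prod_eq_one fun α _ => ?_
  by_cases hj : jump (n α) s = 0
  · simp [hj]
  · have h1 : 0 < 1 + rate L ψ α s := by linarith [hpos α s hs.2 hj]
    rw [pow_right_comm, ← mul_pow, hcoeff α s hs.2 hj, coeff, inv_pow, Real.sq_sqrt h1.le,
      mul_inv_cancel₀ h1.ne', one_pow]

omit [CompleteSpace E] in
lemma star_mul_self_eq_inv_inner {x : ℝ} {v : E} (h : x ^ 2 * ‖v‖ ^ 2 = 1) :
    star (x : ℂ) * (x : ℂ) = (inner ℂ v v)⁻¹ := by
  have h1 : inner ℂ v v = ((‖v‖ ^ 2 : ℝ) : ℂ) := by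
    rw [inner_self_eq_norm_sq_to_K]; norm_cast
  rw [h1, ← Complex.ofReal_inv, ← eq_inv_of_mul_eq_one_left h]
  simp [sq]

omit [CompleteSpace E] in
lemma norm_smul_eq_one {x : ℝ} {v : E} (h : x ^ 2 * ‖v‖ ^ 2 = 1) : ‖(x : ℂ) • v‖ = 1 := by
  rw [norm_smul, Complex.norm_real, ← sq_eq_sq₀ (by positivity) one_pos.le, mul_pow, one_pow,
    Real.norm_eq_abs, sq_abs, h]

lemma IsSolutionPath.timeIntegrable_min_coeff (hψ : IsSolutionPath n H L φ₀ ψ) (α : ι) (m : ℕ)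
    (t : ℝ≥0) : TimeIntegrable (fun s => min (coeff L ψ α s) m) t := by
  have hm : Measurable (coeff L ψ α) :=
    ((hψ.stronglyMeasurable_rate α).measurable.const_add 1).sqrt.inv
  refine timeIntegrable_of_bounded (C := m) (hm.min measurable_const).stronglyMeasurable
    fun s _ => ?_
  have h0 : 0 ≤ coeff L ψ α s := inv_nonneg.2 (Real.sqrt_nonneg _)
  rw [Real.norm_of_nonneg (le_min h0 m.cast_nonneg)]
  exact min_le_right _ _

lemma eventually_min_coeff_eq (L : ι → E →L[ℂ] E) (ψ : ℝ≥0 → E) (hn : ∀ α, Monotone (n α)) (t : ℝ≥0) :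
    ∀ᶠ m : ℕ in atTop, ∀ α, ∀ s ∈ Set.Ioc 0 t, jump (n α) s ≠ 0 →
      min (coeff L ψ α s) m = coeff L ψ α s := by
  have h : ∀ᶠ m : ℕ in atTop, ∀ α, ∀ s ∈ jumpSet n ∩ Set.Ioc 0 t,
      min (coeff L ψ α s) m = coeff L ψ α s := by
    rw [eventually_all]
    intro α
    rw [(finite_jumpSet hn t).eventually_all]
    intro s _
    filter_upwards [tendsto_natCast_atTop_atTop.eventually_ge_atTop (coeff L ψ α s)] with m hm
      using min_eq_left hm
  filter_upwards [h] with m hm α s hs hj using hm α s ⟨⟨α, hj⟩, hs⟩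

end Solution

end PoissonUnravelling

open PoissonUnravelling in
theorem lemma3 {Ω : Type*} [MeasurableSpace Ω] (P : Measure Ω) [IsProbabilityMeasure P]
    {ι : Type*} [Fintype ι] (N : ι → ℝ≥0 → Ω → ℕ) (hN : IsPoissonFamily P N)
    {E : Type*} [NormedAddCommGroup E] [InnerProductSpace ℂ E] [CompleteSpace E]
    (H : E →ₗ.[ℂ] E) (hH : IsSelfAdjoint H) (L : ι → E →L[ℂ] E)
    (φ₀ : E) (hφ₀ : ‖φ₀‖ = 1) (ψ : ℝ≥0 → Ω → E)
    (hψ : ∀ᵐ ω ∂P, IsSolutionPath (fun α s => N α s ω) H L φ₀ (fun s => ψ s ω)) :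
    ∀ᵐ ω ∂P, ∀ t : ℝ≥0,
      -- `ψ` is nonzero at time `t` exactly when no jump up to `t` has `R_α = -1`
      (ψ t ω ≠ 0 ↔ ∀ α, ∀ s ∈ Set.Ioc 0 t, jump (fun s => N α s ω) s ≠ 0 →
        -1 < rate L (fun s => ψ s ω) α s) ∧
      -- `Φ* Φ` is the inverse of the norm squared, so `Φ` normalizes `ψ`
      (ψ t ω ≠ 0 → (∀ α, TimeIntegrable (coeff L (fun s => ψ s ω) α) t) →
        star (Phi (fun α s => N α s ω) L (fun s => ψ s ω) t) *
            Phi (fun α s => N α s ω) L (fun s => ψ s ω) t = (inner ℂ (ψ t ω) (ψ t ω))⁻¹ ∧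
          ‖Phi (fun α s => N α s ω) L (fun s => ψ s ω) t • ψ t ω‖ = 1) ∧
      -- if some `c_α` is not integrable, the same holds in the limit of the truncations
      (ψ t ω ≠ 0 → Tendsto (fun m : ℕ =>
          star (PhiTrunc (fun α s => N α s ω) L (fun s => ψ s ω) m t) *
            PhiTrunc (fun α s => N α s ω) L (fun s => ψ s ω) m t)
        atTop (𝓝 (inner ℂ (ψ t ω) (ψ t ω))⁻¹)) := by
  filter_upwards [hN.ae_isSimpleFamily, hψ] with ω hn hsol t
  refine ⟨hsol.ne_zero_iff hH hn hφ₀ t, fun hne hc => ?_, fun hne => ?_⟩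
  · have h := hsol.normalizer_sq_mul_norm_sq hH hn hφ₀ hne hc fun _ _ _ _ => rfl
    exact ⟨star_mul_self_eq_inv_inner h, norm_smul_eq_one h⟩
  · refine tendsto_const_nhds.congr' ?_
    filter_upwards [eventually_min_coeff_eq L (fun s => ψ s ω) hn.mono t] with m hm
    exact (star_mul_self_eq_inv_inner (hsol.normalizer_sq_mul_norm_sq hH hn hφ₀ hne
      (fun α => hsol.timeIntegrable_min_coeff α m t) hm)).symm
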